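/- Let $\theta>0$ be real and let $\psi(s)=\Gamma'(s)/\Gamma(s)$ be the digamma function. There exists a function $\Psi_\theta:\mathbb{R}\to\mathbb{R}$, continuous on $\mathbb{R}\setminus\{0\}$ (and continuous on all of $\mathbb{R}$ if $\theta>1$) and continuously differentiable on $(0,\infty)$, such that the following hold. For every complex $z$ with $\operatorname{Im} z>-1/2$ the integral below converges absolutely and $$\exp(-\theta\,\psi(s))=\int_0^\infty \Psi_\theta(x)\,e^{izx}\,dx,\qquad s=\tfrac12-iz.$$ Moreover $\Psi_\theta(x)=0$ for all $x<0$; $\Psi_\theta(x)=\dfrac{x^{\theta-1}}{\Gamma(\theta)}+O(x^{\theta})$ as $x\to0^+$; and, for every real $\kappa<1/2$, $\Psi_\theta(x)\ll e^{-\kappa x}$ as $x\to+\infty$. The implied constants may depend on $\theta$ and, in the last bound, on $\kappa$. -/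

import Mathlib

open Set Filter Topology MeasureTheory Asymptotics

/-! Gauss' integral says `ψ(s) = log s - L(s)`, where `L` is the Laplace transform of the smooth
bounded kernel `g(t) = 1/(1 - exp(-t)) - 1/t` (`realDigamma_eq_log_sub_laplace`). Hence `exp(-θ
ψ(s)) = s^(-θ) * exp(θ L(s))`. The first factor is the Laplace transform of `t^(θ-1)/Γ(θ)`. The
second is that of `δ₀ + h`, where `h = ∑ θ^(n+1)/(n+1)! * g^{*(n+1)}` is `gaussConvExp`
(`laplace_gaussConvExp`). The product is therefore the transform of `x^(θ-1)/Γ(θ)` plus its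
convolution with `h`. Since `exp(i z x) = exp(x/2) * exp(-s x)` for `s = 1/2 - i z`, `Ψ` is this
function times `exp(-x/2)`.

The substitution `t = x u` in the convolution exhibits `Ψ` as `x^(θ-1)/Γ(θ)` times a C¹ function
equal to 1 at 0, which gives the regularity and the behaviour at 0. The bound `|g| ≤ 1` makes `h`
grow more slowly than every `exp(ε x)`, which gives the decay. The transform formula is proved for
real `s > 0` and extended to `Re s > 0` by the identity theorem (`exp_neg_mul_digamma_eq_integral`).
-/

/-! ### The Gauss kernel: smoothness and bounds. -/

theorem AnalyticAt.dslope_of_forall {f : ℝ → ℝ} (hf : ∀ x, AnalyticAt ℝ f x) (a b : ℝ) :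
    AnalyticAt ℝ (dslope f a) b := by
  rcases eq_or_ne b a with rfl | h
  · obtain ⟨p, hp⟩ := hf b
    exact ⟨_, hp.has_fpower_series_dslope_fslope⟩
  · have h1 : AnalyticAt ℝ (fun x => (x - a)⁻¹ * (f x - f a)) b :=
      ((analyticAt_id.sub analyticAt_const).inv (sub_ne_zero.2 h)).mul
        ((hf b).sub analyticAt_const)
    refine h1.congr ?_
    filter_upwards [dslope_eventuallyEq_slope_of_ne f h] with x hx
    rw [hx, slope_def_field, div_eq_inv_mul]

/-- The entire function `(1 - exp (-t)) / t`. -/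
noncomputable def expQuotient : ℝ → ℝ := dslope (fun u => 1 - Real.exp (-u)) 0

theorem expQuotient_of_ne {t : ℝ} (ht : t ≠ 0) : expQuotient t = (1 - Real.exp (-t)) / t := by
  rw [expQuotient, dslope_of_ne _ ht, slope_def_field]
  simp

theorem expQuotient_zero : expQuotient 0 = 1 := by
  have : HasDerivAt (fun u : ℝ => 1 - Real.exp (-u)) 1 0 := by
    simpa using ((hasDerivAt_neg (0 : ℝ)).exp).const_sub 1
  rw [expQuotient, dslope_same, this.deriv]

theorem expQuotient_pos (t : ℝ) : 0 < expQuotient t := by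
  rcases lt_trichotomy t 0 with h | rfl | h
  · rw [expQuotient_of_ne h.ne]
    exact div_pos_of_neg_of_neg (by simpa using h) h
  · simp [expQuotient_zero]
  · rw [expQuotient_of_ne h.ne']
    exact div_pos (by simpa using h) h

theorem analyticAt_expQuotient (t : ℝ) : AnalyticAt ℝ expQuotient t :=
  AnalyticAt.dslope_of_forall (fun _ => by fun_prop) 0 t

/-- The smooth kernel `1 / (1 - exp (-t)) - 1 / t` of Gauss' integral for the digamma function. -/
noncomputable def gaussKernel (t : ℝ) : ℝ := -dslope expQuotient 0 t / expQuotient t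

theorem gaussKernel_of_ne {t : ℝ} (ht : t ≠ 0) :
    gaussKernel t = (1 - Real.exp (-t))⁻¹ - t⁻¹ := by
  have h : 1 - Real.exp (-t) ≠ 0 := by
    have := (expQuotient_pos t).ne'
    rw [expQuotient_of_ne ht] at this
    exact fun h => this (by simp [h])
  rw [gaussKernel, dslope_of_ne _ ht, slope_def_field, expQuotient_zero, expQuotient_of_ne ht]
  field_simp
  ring

theorem one_sub_exp_mul_gaussKernel {t : ℝ} (ht : t ≠ 0) :
    (1 - Real.exp (-t)) * gaussKernel t = 1 - expQuotient t := by
  have h := (expQuotient_pos t).ne'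
  have h' := expQuotient_of_ne ht
  rw [eq_div_iff ht] at h'
  rw [gaussKernel, dslope_of_ne _ ht, slope_def_field, expQuotient_zero, ← h']
  field_simp
  ring

theorem contDiff_gaussKernel {n : WithTop ℕ∞} : ContDiff ℝ n gaussKernel := by
  rw [contDiff_iff_contDiffAt]
  intro t
  refine AnalyticAt.contDiffAt ?_
  exact (AnalyticAt.dslope_of_forall analyticAt_expQuotient 0 t).neg.div
    (analyticAt_expQuotient t) (expQuotient_pos t).ne'

theorem gaussKernel_mem_Icc {t : ℝ} (ht : 0 < t) : gaussKernel t ∈ Icc 0 1 := by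
  have h1 : 0 < 1 - Real.exp (-t) := by simpa using ht
  rw [gaussKernel_of_ne ht.ne']
  constructor
  · rw [sub_nonneg]
    apply inv_anti₀ h1
    linarith [Real.add_one_le_exp (-t)]
  · have h2 : Real.exp (-t) * (1 + t) ≤ 1 := by
      rw [Real.exp_neg, inv_mul_le_iff₀ (Real.exp_pos t)]
      linarith [Real.add_one_le_exp t]
    have h3 : (1 - Real.exp (-t))⁻¹ ≤ 1 + t⁻¹ := by
      rw [inv_le_iff_one_le_mul₀ h1]
      field_simp
      linarith
    linarith

theorem gaussKernel_neg {t : ℝ} (ht : t ≠ 0) : gaussKernel (-t) = 1 - gaussKernel t := by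
  have h1 : 1 - Real.exp (-t) ≠ 0 := by
    rw [sub_ne_zero, ne_comm, Ne, Real.exp_eq_one_iff]
    simpa using ht
  have h2 : 1 - Real.exp t ≠ 0 := by
    rw [sub_ne_zero, ne_comm, Ne, Real.exp_eq_one_iff]
    exact ht
  have h3 : (1 - Real.exp t)⁻¹ = 1 - (1 - Real.exp (-t))⁻¹ := by
    have := Real.exp_pos t
    rw [Real.exp_neg] at *
    have h4 : Real.exp t - 1 ≠ 0 := fun h => h2 (by linarith)
    field_simp
    ring
  rw [gaussKernel_of_ne ht, gaussKernel_of_ne (neg_ne_zero.2 ht), neg_neg, h3, inv_neg]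
  ring

/-- The reflection `t ↦ -t` carries the bounds on the positive axis to the negative axis, and
continuity covers `t = 0`. A bound on the whole line lets convolutions be estimated for either sign
of `x`. -/
theorem abs_gaussKernel_le_one (t : ℝ) : |gaussKernel t| ≤ 1 := by
  have hcl : IsClosed {t : ℝ | |gaussKernel t| ≤ 1} :=
    isClosed_le (contDiff_gaussKernel (n := 0)).continuous.abs continuous_const
  have hs : ({0}ᶜ : Set ℝ) ⊆ {t : ℝ | |gaussKernel t| ≤ 1} := by
    intro t ht
    rw [mem_ofPred, abs_le]
    rcases lt_or_gt_of_ne (show t ≠ 0 from ht) with h | h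
    · have h1 := gaussKernel_mem_Icc (neg_pos.2 h)
      have h2 := gaussKernel_neg (neg_pos.2 h).ne'
      rw [neg_neg] at h2
      constructor <;> linarith [h1.1, h1.2]
    · have h1 := gaussKernel_mem_Icc h
      constructor <;> linarith [h1.1, h1.2]
  have := hcl.closure_subset_iff.2 hs
  rw [(dense_compl_singleton (0 : ℝ)).closure_eq] at this
  exact this (mem_univ t)

/-! ### Gauss' integral for the digamma function on the positive reals. -/

/-- The real Laplace transform over the positive half-line. -/
noncomputable def laplace (f : ℝ → ℝ) (s : ℝ) : ℝ := ∫ t in Ioi (0 : ℝ), f t * Real.exp (-(s * t))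

theorem integrableOn_exp_neg_mul_Ioi {s : ℝ} (hs : 0 < s) :
    IntegrableOn (fun t : ℝ => Real.exp (-(s * t))) (Ioi 0) := by
  simpa using integrableOn_exp_mul_Ioi (neg_lt_zero.2 hs) 0

theorem integral_exp_neg_mul_Ioi_zero {s : ℝ} (hs : 0 < s) :
    ∫ t in Ioi (0 : ℝ), Real.exp (-(s * t)) = s⁻¹ := by
  simpa [neg_div] using integral_exp_mul_Ioi (neg_lt_zero.2 hs) 0

theorem integrableOn_gaussKernel_mul_exp {s : ℝ} (hs : 0 < s) :
    IntegrableOn (fun t : ℝ => gaussKernel t * Real.exp (-(s * t))) (Ioi 0) :=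
  (integrableOn_exp_neg_mul_Ioi hs).bdd_mul
    (contDiff_gaussKernel (n := 0)).continuous.aestronglyMeasurable
    (ae_of_all _ abs_gaussKernel_le_one)

theorem abs_laplace_gaussKernel_le {s : ℝ} (hs : 0 < s) : |laplace gaussKernel s| ≤ s⁻¹ := by
  rw [← integral_exp_neg_mul_Ioi_zero hs, ← Real.norm_eq_abs, laplace]
  refine norm_integral_le_of_norm_le (integrableOn_exp_neg_mul_Ioi hs) (ae_of_all _ fun t => ?_)
  rw [norm_mul, Real.norm_eq_abs, Real.norm_of_nonneg (Real.exp_pos _).le]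
  exact mul_le_of_le_one_left (Real.exp_pos _).le (abs_gaussKernel_le_one t)

/-- Shifting `s` by 1 inserts the factor `1 - exp(-t)`, which turns the kernel into `1 - (1 -
exp(-t))/t`. The second piece is a Frullani integral. -/
theorem laplace_gaussKernel_sub_add_one {s : ℝ} (hs : 0 < s) :
    laplace gaussKernel s - laplace gaussKernel (s + 1) =
      s⁻¹ - (Real.log (s + 1) - Real.log s) := by
  have hs1 : 0 < s + 1 := by linarith
  have hi1 := integrableOn_gaussKernel_mul_exp hs
  have hi2 := integrableOn_gaussKernel_mul_exp hs1
  have hi3 := integrableOn_exp_neg_mul_Ioi hs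
  have key : EqOn (fun t : ℝ => t⁻¹ • (Real.exp (-(s * t)) - Real.exp (-((s + 1) * t))))
      (fun t => Real.exp (-(s * t)) - (gaussKernel t * Real.exp (-(s * t))
        - gaussKernel t * Real.exp (-((s + 1) * t)))) (Ioi 0) := by
    intro t ht
    have ht' : t ≠ 0 := (ne_of_gt ht)
    have h1 := one_sub_exp_mul_gaussKernel ht'
    rw [expQuotient_of_ne ht'] at h1
    have h2 : Real.exp (-((s + 1) * t)) = Real.exp (-(s * t)) * Real.exp (-t) := by
      rw [← Real.exp_add]; ring_nf
    have h3 : t⁻¹ * (1 - Real.exp (-t)) = 1 - (1 - Real.exp (-t)) * gaussKernel t := by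
      rw [h1]; ring
    simp only [smul_eq_mul, h2]
    linear_combination Real.exp (-(s * t)) * h3
  have hint := (hi3.sub (hi1.sub hi2))
  -- `L` and `R` are the limits of `exp(-x)` at `0` and at infinity.
  have hF := Frullani.integral_Ioi_eq (f := fun x : ℝ => Real.exp (-x)) (a := s) (b := s + 1)
    (L := 1) (R := 0)
    ((by fun_prop : Continuous fun x : ℝ => Real.exp (-x)).locallyIntegrable.locallyIntegrableOn _)
    hs hs1
    (by
      have : Tendsto (fun x : ℝ => Real.exp (-x)) (𝓝 0) (𝓝 (Real.exp (-0))) :=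
        (by fun_prop : Continuous fun x : ℝ => Real.exp (-x)).tendsto 0
      simpa using this.mono_left nhdsWithin_le_nhds)
    Real.tendsto_exp_neg_atTop_nhds_zero
    (hint.congr_fun (fun t ht => (key ht).symm) measurableSet_Ioi)
  have hsub := integral_sub hi3 (hi1.sub hi2)
  simp only [Pi.sub_apply] at hsub
  rw [setIntegral_congr_fun measurableSet_Ioi key, hsub, integral_sub hi1 hi2,
    integral_exp_neg_mul_Ioi_zero hs, Real.log_div hs1.ne' hs.ne'] at hF
  simp only [laplace]
  simp only [sub_zero, smul_eq_mul, mul_one] at hF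
  linarith

/-- The digamma function on the real line. -/
noncomputable def realDigamma (s : ℝ) : ℝ := deriv Real.Gamma s / Real.Gamma s

theorem digamma_ofReal {s : ℝ} (hs : 0 < s) : Complex.digamma s = (realDigamma s : ℂ) := by
  have h0 : ∀ m : ℕ, s ≠ -m := fun m h => by
    have : (0 : ℝ) ≤ m := m.cast_nonneg
    linarith
  have h1 := (Real.differentiableAt_Gamma h0).hasDerivAt
  have h2 := (Complex.differentiableAt_Gamma (s : ℂ) (fun m => by exact_mod_cast h0 m)).hasDerivAt
  have h3 := h2.comp_ofReal
  have h4 := h1.ofReal_comp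
  simp only [Complex.Gamma_ofReal] at h3
  rw [Complex.digamma, logDeriv_apply, h3.unique h4, Complex.Gamma_ofReal, realDigamma]
  push_cast
  rfl

theorem hasDerivAt_log_Gamma {s : ℝ} (hs : 0 < s) :
    HasDerivAt (Real.log ∘ Real.Gamma) (realDigamma s) s := by
  have h0 : ∀ m : ℕ, s ≠ -m := fun m h => by
    have : (0 : ℝ) ≤ m := m.cast_nonneg
    linarith
  exact (Real.differentiableAt_Gamma h0).hasDerivAt.log (Real.Gamma_pos_of_pos hs).ne'

theorem log_Gamma_add_one {s : ℝ} (hs : 0 < s) :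
    (Real.log ∘ Real.Gamma) (s + 1) = Real.log s + (Real.log ∘ Real.Gamma) s := by
  simp only [Function.comp]
  rw [Real.Gamma_add_one hs.ne', Real.log_mul hs.ne' (Real.Gamma_pos_of_pos hs).ne']

theorem realDigamma_add_one {s : ℝ} (hs : 0 < s) : realDigamma (s + 1) = realDigamma s + s⁻¹ := by
  have h1 : HasDerivAt (fun x => (Real.log ∘ Real.Gamma) (x + 1)) (realDigamma (s + 1)) s :=
    (hasDerivAt_log_Gamma (by linarith : 0 < s + 1)).comp_add_const s 1
  have h2 := (Real.hasDerivAt_log hs.ne').add (hasDerivAt_log_Gamma hs)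
  have h3 : (fun x => (Real.log ∘ Real.Gamma) (x + 1)) =ᶠ[𝓝 s]
      (Real.log + Real.log ∘ Real.Gamma) := by
    filter_upwards [eventually_gt_nhds hs] with x hx using log_Gamma_add_one hx
  rw [(h1.congr_of_eventuallyEq h3.symm).unique h2, add_comm]

/-- By log-convexity the slope of `log Γ` over `[s, s + 1]`, which is `log s`, lies between `ψ(s)`
and `ψ(s + 1) = ψ(s) + 1/s`. -/
theorem abs_realDigamma_sub_log_le {s : ℝ} (hs : 0 < s) :
    |realDigamma s - Real.log s| ≤ s⁻¹ := by
  have hs1 : 0 < s + 1 := by linarith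
  have hsl : slope (Real.log ∘ Real.Gamma) s (s + 1) = Real.log s := by
    rw [slope_def_field, log_Gamma_add_one hs]
    simp
  have h1 := Real.convexOn_log_Gamma.le_slope_of_hasDerivAt (mem_Ioi.2 hs) (mem_Ioi.2 hs1)
    (by linarith) (hasDerivAt_log_Gamma hs)
  have h2 := Real.convexOn_log_Gamma.slope_le_of_hasDerivAt (mem_Ioi.2 hs) (mem_Ioi.2 hs1)
    (by linarith) (hasDerivAt_log_Gamma hs1)
  rw [hsl] at h1 h2
  rw [realDigamma_add_one hs] at h2
  have := inv_pos.2 hs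
  rw [abs_le]
  constructor <;> linarith

/-- Gauss' integral for the digamma function, on the positive reals. -/
theorem realDigamma_eq_log_sub_laplace {s : ℝ} (hs : 0 < s) :
    realDigamma s = Real.log s - laplace gaussKernel s := by
  -- Both sides grow by `s⁻¹` under `s ↦ s + 1`, so their difference `D` is constant along `s + n`,
  -- while it is at most `2/(s + n)` there. Hence it vanishes.
  set D : ℝ → ℝ := fun s => realDigamma s - Real.log s + laplace gaussKernel s with hD
  have hper : ∀ n : ℕ, D (s + n) = D s := by
    intro n
    induction n with
    | zero => simp
    | succ n ih =>
      have hn : 0 < s + n := by positivity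
      rw [← ih, Nat.cast_succ, ← add_assoc]
      have h1 := realDigamma_add_one hn
      have h2 := laplace_gaussKernel_sub_add_one hn
      simp only [hD]
      linarith
  have hbd : ∀ n : ℕ, |D s| ≤ 2 * (s + n)⁻¹ := by
    intro n
    have hn : 0 < s + n := by positivity
    rw [← hper n]
    have h1 := abs_realDigamma_sub_log_le hn
    have h2 := abs_laplace_gaussKernel_le hn
    have h3 := abs_add_le (realDigamma (s + n) - Real.log (s + n)) (laplace gaussKernel (s + n))
    simp only [hD]
    linarith
  have hlim : Tendsto (fun n : ℕ => 2 * (s + n)⁻¹) atTop (𝓝 0) := by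
    have : Tendsto (fun n : ℕ => s + (n : ℝ)) atTop atTop :=
      tendsto_atTop_add_const_left _ _ tendsto_natCast_atTop_atTop
    simpa using this.inv_tendsto_atTop.const_mul 2
  have h0 : |D s| ≤ 0 := ge_of_tendsto' hlim hbd
  have : D s = 0 := abs_nonpos_iff.1 h0
  simp only [hD] at this
  linarith

/-! ### Convolution with a C¹ kernel, convolution powers and their series. -/

/-- The two occurrences of `x` are separated into an endpoint `a` and a parameter `b`. Both partial
derivatives are continuous, so the function is jointly differentiable and can be restricted to the
diagonal. -/
theorem hasDerivAt_integral_mul_comp_sub {q f : ℝ → ℝ} (hq : Continuous q) (hf : ContDiff ℝ 1 f)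
    (x : ℝ) : HasDerivAt (fun x => ∫ t in (0 : ℝ)..x, q t * f (x - t))
      (q x * f 0 + ∫ t in (0 : ℝ)..x, q t * deriv f (x - t)) x := by
  have hf' : Continuous (deriv f) := hf.continuous_deriv le_rfl
  have hfc : Continuous f := hf.continuous
  have hd : ∀ y, HasDerivAt f (deriv f y) y := fun y =>
    (hf.differentiable one_ne_zero y).hasDerivAt
  have h1 : ∀ a b : ℝ, HasDerivAt (fun a => ∫ t in (0 : ℝ)..a, q t * f (b - t))
      (q a * f (b - a)) a := fun a b =>
    (show Continuous fun t => q t * f (b - t) by fun_prop).integral_hasStrictDerivAt 0 a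
      |>.hasDerivAt
  have h2 : ∀ a b : ℝ, HasDerivAt (fun b => ∫ t in (0 : ℝ)..a, q t * f (b - t))
      (∫ t in (0 : ℝ)..a, q t * deriv f (b - t)) b := by
    intro a b
    obtain ⟨C, hC⟩ := ((isCompact_closedBall b 1).prod
      (isCompact_uIcc (a := 0) (b := a))).exists_bound_of_continuousOn
      (f := fun p : ℝ × ℝ => q p.2 * deriv f (p.1 - p.2)) (by fun_prop)
    refine (intervalIntegral.hasDerivAt_integral_of_dominated_loc_of_deriv_le
      (F := fun b t => q t * f (b - t)) (F' := fun b t => q t * deriv f (b - t))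
      (bound := fun _ => C) (Metric.closedBall_mem_nhds b one_pos)
      (Eventually.of_forall fun y => (by fun_prop : Continuous _).aestronglyMeasurable)
      ((by fun_prop : Continuous _).intervalIntegrable _ _)
      (by fun_prop : Continuous _).aestronglyMeasurable
      (ae_of_all _ fun t ht y hy => hC (y, t) ⟨hy, uIoc_subset_uIcc ht⟩)
      (by simp) (ae_of_all _ fun t _ y _ => ?_)).2
    exact ((hd (y - t)).comp_sub_const y t).const_mul (q t)
  have key := hasStrictFDerivAt_uncurry_coprod (𝕜 := ℝ) (u := (x, x))
    (f := fun a b : ℝ => ∫ t in (0 : ℝ)..a, q t * f (b - t))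
    (f₁ := fun a b => ContinuousLinearMap.toSpanSingleton ℝ (q a * f (b - a)))
    (f₂ := fun a b => ContinuousLinearMap.toSpanSingleton ℝ
      (∫ t in (0 : ℝ)..a, q t * deriv f (b - t)))
    (Eventually.of_forall fun v => (h1 v.1 v.2).hasFDerivAt)
    (Eventually.of_forall fun v => (h2 v.1 v.2).hasFDerivAt)
    ((ContinuousLinearMap.toSpanSingletonCLE (𝕜 := ℝ) (E := ℝ)).continuous.comp
      (show Continuous fun p : ℝ × ℝ => q p.1 * f (p.2 - p.1) by fun_prop)).continuousAt
    ((ContinuousLinearMap.toSpanSingletonCLE (𝕜 := ℝ) (E := ℝ)).continuous.comp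
      (show Continuous fun p : ℝ × ℝ => ∫ t in (0 : ℝ)..p.1, q t * deriv f (p.2 - t) from
        intervalIntegral.continuous_parametric_intervalIntegral_of_continuous
          (by fun_prop) continuous_fst)).continuousAt
  have hdiag : HasDerivAt (fun y : ℝ => (y, y)) (1, 1) x :=
    (hasDerivAt_id x).prodMk (hasDerivAt_id x)
  have := HasFDerivAt.comp_hasDerivAt (f := fun y : ℝ => (y, y)) x key.hasFDerivAt hdiag
  simpa [Function.HasUncurry.uncurry, Function.comp_def] using this

theorem contDiff_integral_mul_comp_sub {q f : ℝ → ℝ} (hq : Continuous q) (hf : ContDiff ℝ 1 f) :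
    ContDiff ℝ 1 (fun x => ∫ t in (0 : ℝ)..x, q t * f (x - t)) := by
  have hf' : Continuous (deriv f) := hf.continuous_deriv le_rfl
  have hfc : Continuous f := hf.continuous
  have h := hasDerivAt_integral_mul_comp_sub hq hf
  rw [contDiff_one_iff_deriv]
  refine ⟨fun x => (h x).differentiableAt, ?_⟩
  rw [funext fun x => (h x).deriv]
  exact (by fun_prop : Continuous fun x => q x * f 0).add
    (intervalIntegral.continuous_parametric_intervalIntegral_of_continuous
          (by fun_prop) continuous_id)

/-- The convolution powers (over the half-line) of `gaussKernel`, of exponent `n + 1`. -/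
noncomputable def gaussConvPow : ℕ → ℝ → ℝ
  | 0 => gaussKernel
  | n + 1 => fun x => ∫ t in (0 : ℝ)..x, gaussConvPow n t * gaussKernel (x - t)

theorem continuous_gaussKernel : Continuous gaussKernel :=
  (contDiff_gaussKernel (n := 0)).continuous

theorem continuous_gaussConvPow (n : ℕ) : Continuous (gaussConvPow n) := by
  induction n with
  | zero => exact continuous_gaussKernel
  | succ n ih =>
    have := continuous_gaussKernel
    exact intervalIntegral.continuous_parametric_intervalIntegral_of_continuous
      (by fun_prop) continuous_id

/-- Each convolution with a kernel bounded by 1 costs one integration. The factorial makes series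
with bounded coefficients converge locally uniformly. -/
theorem abs_gaussConvPow_le (n : ℕ) (x : ℝ) :
    |gaussConvPow n x| ≤ |x| ^ n / n.factorial := by
  induction n generalizing x with
  | zero => simpa [gaussConvPow] using abs_gaussKernel_le_one x
  | succ n ih =>
    have h1 : ∫ t in uIoc 0 x, |t| ^ n / n.factorial = |x| ^ (n + 1) / (n + 1).factorial := by
      have := integral_pow_abs_sub_uIoc (a := 0) (b := x) n
      simp only [sub_zero] at this
      rw [integral_div, this, Nat.factorial_succ]
      push_cast
      rw [div_div]
    rw [← h1, ← Real.norm_eq_abs, gaussConvPow]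
    refine intervalIntegral.norm_integral_le_integral_norm_uIoc.trans ?_
    have hc := continuous_gaussConvPow n
    have hk := continuous_gaussKernel
    refine integral_mono ?_ ?_ fun t => ?_
    · exact intervalIntegrable_iff.1 ((by fun_prop : Continuous _).intervalIntegrable _ _)
    · exact intervalIntegrable_iff.1 ((by fun_prop : Continuous _).intervalIntegrable _ _)
    · simp only [norm_mul]
      exact (mul_le_of_le_one_right (norm_nonneg _) (abs_gaussKernel_le_one _)).trans (ih t)

/-- Series in the convolution powers of `gaussKernel`. -/
noncomputable def gaussConvSeries (a : ℕ → ℝ) (x : ℝ) : ℝ := ∑' n, a n * gaussConvPow n x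

section Series

variable {a : ℕ → ℝ} {M : ℝ}

theorem norm_mul_gaussConvPow_le (ha : ∀ n, |a n| ≤ M) {R x : ℝ} (hx : |x| ≤ R) (n : ℕ) :
    ‖a n * gaussConvPow n x‖ ≤ M * (R ^ n / n.factorial) := by
  rw [norm_mul]
  refine mul_le_mul (ha n) ((abs_gaussConvPow_le n x).trans ?_) (norm_nonneg _)
    ((abs_nonneg _).trans (ha n))
  gcongr

theorem hasSum_gaussConvSeries (ha : ∀ n, |a n| ≤ M) (x : ℝ) :
    HasSum (fun n => a n * gaussConvPow n x) (gaussConvSeries a x) :=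
  (Summable.of_norm_bounded ((Real.summable_pow_div_factorial |x|).mul_left M)
    (norm_mul_gaussConvPow_le ha le_rfl)).hasSum

theorem continuous_gaussConvSeries (ha : ∀ n, |a n| ≤ M) : Continuous (gaussConvSeries a) := by
  rw [continuous_iff_continuousAt]
  intro x
  have h : ContinuousOn (gaussConvSeries a) (Metric.closedBall 0 (|x| + 1)) :=
    continuousOn_tsum (fun n => ((continuous_gaussConvPow n).const_mul (a n)).continuousOn)
      ((Real.summable_pow_div_factorial (|x| + 1)).mul_left M)
      fun n y hy => norm_mul_gaussConvPow_le ha (by simpa using hy) n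
  exact h.continuousAt (Metric.closedBall_mem_nhds_of_mem (by simp))

/-- Peeling off the first term leaves a convolution of a continuous function with the smooth kernel,
so the sum is C¹ without any termwise differentiation. -/
theorem gaussConvSeries_eq (ha : ∀ n, |a n| ≤ M) (x : ℝ) :
    gaussConvSeries a x = a 0 * gaussKernel x +
      ∫ t in (0 : ℝ)..x, gaussConvSeries (fun n => a (n + 1)) t * gaussKernel (x - t) := by
  have ha' : ∀ n, |a (n + 1)| ≤ M := fun n => ha (n + 1)
  have hk := continuous_gaussKernel
  have hs : HasSum (fun n => ∫ t in (0 : ℝ)..x, a (n + 1) * gaussConvPow n t * gaussKernel (x - t))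
      (∫ t in (0 : ℝ)..x, gaussConvSeries (fun n => a (n + 1)) t * gaussKernel (x - t)) := by
    refine intervalIntegral.hasSum_integral_of_dominated_convergence
      (fun n _ => M * (|x| ^ n / n.factorial)) (fun n => ?_)
      (fun n => ae_of_all _ fun t ht => ?_)
      (ae_of_all _ fun t _ => (Real.summable_pow_div_factorial |x|).mul_left M) (by simp)
      (ae_of_all _ fun t _ => (hasSum_gaussConvSeries ha' t).mul_right _)
    · have := continuous_gaussConvPow n
      exact (by fun_prop : Continuous _).aestronglyMeasurable
    · rw [norm_mul]
      have htx : |t| ≤ |x| := by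
        rcases le_total 0 x with h | h
        · rw [uIoc_of_le h] at ht
          rw [abs_of_nonneg h, abs_of_pos ht.1]; exact ht.2
        · rw [uIoc_of_ge h] at ht
          rw [abs_of_nonpos h, abs_of_nonpos ht.2]; linarith [ht.1]
      exact (mul_le_of_le_one_right (norm_nonneg _) (abs_gaussKernel_le_one _)).trans
        (norm_mul_gaussConvPow_le ha' htx n)
  have h0 := (hasSum_gaussConvSeries ha x)
  have h1 := (hasSum_nat_add_iff' 1).2 h0
  have h2 := hs.unique (h1.congr_fun fun n => ?_)
  · rw [h2]; simp [gaussConvPow]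
  · simp only [gaussConvPow]
    rw [← intervalIntegral.integral_const_mul]
    simp only [mul_assoc]

theorem contDiff_gaussConvSeries (ha : ∀ n, |a n| ≤ M) : ContDiff ℝ 1 (gaussConvSeries a) := by
  rw [funext (gaussConvSeries_eq ha)]
  exact (contDiff_const.mul contDiff_gaussKernel).add
    (contDiff_integral_mul_comp_sub (continuous_gaussConvSeries fun n => ha (n + 1))
      contDiff_gaussKernel)

end Series

/-! ### Laplace transforms of convolutions and of convolution powers. -/

section Convolution

variable {f g : ℝ → ℝ} {s : ℝ}

/-- The weight is multiplicative, `exp(-s x) = exp(-s t) * exp(-s (x - t))`, so it can be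
distributed over the two factors. -/
theorem indicator_integral_mul_exp_eq_posConvolution (f g : ℝ → ℝ) (s : ℝ) :
    indicator (Ioi 0) (fun x => (∫ t in (0 : ℝ)..x, f t * g (x - t)) * Real.exp (-(s * x))) =
      posConvolution (fun t => f t * Real.exp (-(s * t))) (fun t => g t * Real.exp (-(s * t)))
        (ContinuousLinearMap.mul ℝ ℝ) := by
  rw [posConvolution]
  congr 1
  ext x
  rw [← intervalIntegral.integral_mul_const]
  refine intervalIntegral.integral_congr fun t _ => ?_
  have : Real.exp (-(s * x)) = Real.exp (-(s * t)) * Real.exp (-(s * (x - t))) := by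
    rw [← Real.exp_add]; ring_nf
  simp only [ContinuousLinearMap.mul_apply', this]
  ring

theorem integrableOn_integral_mul_comp_sub_mul_exp
    (hf : IntegrableOn (fun t => f t * Real.exp (-(s * t))) (Ioi 0))
    (hg : IntegrableOn (fun t => g t * Real.exp (-(s * t))) (Ioi 0)) :
    IntegrableOn (fun x => (∫ t in (0 : ℝ)..x, f t * g (x - t)) * Real.exp (-(s * x)))
      (Ioi 0) := by
  rw [← integrable_indicator_iff measurableSet_Ioi, indicator_integral_mul_exp_eq_posConvolution]
  exact integrable_posConvolution hf hg _

theorem laplace_integral_mul_comp_sub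
    (hf : IntegrableOn (fun t => f t * Real.exp (-(s * t))) (Ioi 0))
    (hg : IntegrableOn (fun t => g t * Real.exp (-(s * t))) (Ioi 0)) :
    laplace (fun x => ∫ t in (0 : ℝ)..x, f t * g (x - t)) s = laplace f s * laplace g s := by
  have h := integral_posConvolution hf hg (ContinuousLinearMap.mul ℝ ℝ)
  rw [laplace, ← integral_indicator measurableSet_Ioi,
    indicator_integral_mul_exp_eq_posConvolution, posConvolution,
    integral_indicator measurableSet_Ioi, h]
  rfl

end Convolution

theorem integrableOn_rpow_mul_exp_neg_mul_Ioi {a s : ℝ} (ha : 0 < a) (hs : 0 < s) :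
    IntegrableOn (fun t : ℝ => t ^ (a - 1) * Real.exp (-(s * t))) (Ioi 0) := by
  -- The integral of a non-integrable function is 0 by convention, so a nonzero value proves
  -- integrability.
  refine Integrable.of_integral_ne_zero ?_
  rw [Real.integral_rpow_mul_exp_neg_mul_Ioi ha hs]
  have := Real.Gamma_pos_of_pos ha
  positivity

theorem integral_pow_div_factorial_mul_exp (n : ℕ) {s : ℝ} (hs : 0 < s) :
    ∫ t in Ioi (0 : ℝ), t ^ n / n.factorial * Real.exp (-(s * t)) = s⁻¹ ^ (n + 1) := by
  have h := Real.integral_rpow_mul_exp_neg_mul_Ioi (a := n + 1) (by positivity) hs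
  simp only [add_sub_cancel_right, Real.rpow_natCast, Real.Gamma_nat_eq_factorial] at h
  have h2 : (1 / s) ^ ((n : ℝ) + 1) = s⁻¹ ^ (n + 1) := by
    rw [one_div, ← Nat.cast_succ, Real.rpow_natCast]
  have h3 : (n.factorial : ℝ) ≠ 0 := by positivity
  simp_rw [div_mul_eq_mul_div]
  rw [integral_div, h, h2, mul_div_cancel_right₀ _ h3]

theorem integrableOn_pow_div_factorial_mul_exp (n : ℕ) {s : ℝ} (hs : 0 < s) :
    IntegrableOn (fun t : ℝ => t ^ n / n.factorial * Real.exp (-(s * t))) (Ioi 0) := by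
  refine Integrable.of_integral_ne_zero ?_
  rw [integral_pow_div_factorial_mul_exp n hs]
  positivity

theorem norm_gaussConvPow_mul_exp_le (n : ℕ) (s : ℝ) {t : ℝ} (ht : 0 ≤ t) :
    ‖gaussConvPow n t * Real.exp (-(s * t))‖ ≤ t ^ n / n.factorial * Real.exp (-(s * t)) := by
  rw [norm_mul, Real.norm_of_nonneg (Real.exp_pos _).le]
  have := abs_gaussConvPow_le n t
  rw [abs_of_nonneg ht] at this
  exact mul_le_mul_of_nonneg_right this (Real.exp_pos _).le

theorem integrableOn_gaussConvPow_mul_exp (n : ℕ) {s : ℝ} (hs : 0 < s) :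
    IntegrableOn (fun t => gaussConvPow n t * Real.exp (-(s * t))) (Ioi 0) := by
  have := continuous_gaussConvPow n
  exact (integrableOn_pow_div_factorial_mul_exp n hs).mono'
    (by fun_prop : Continuous _).aestronglyMeasurable
    (ae_restrict_of_forall_mem measurableSet_Ioi fun t ht =>
      norm_gaussConvPow_mul_exp_le n s (le_of_lt ht))

theorem laplace_gaussConvPow (n : ℕ) {s : ℝ} (hs : 0 < s) :
    laplace (gaussConvPow n) s = laplace gaussKernel s ^ (n + 1) := by
  induction n with
  | zero => simp [gaussConvPow]
  | succ n ih =>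
    rw [pow_succ, ← ih, ← laplace_integral_mul_comp_sub (integrableOn_gaussConvPow_mul_exp n hs)
      (integrableOn_gaussKernel_mul_exp hs)]
    rfl

theorem integral_norm_gaussConvPow_mul_exp_le (n : ℕ) {s : ℝ} (hs : 0 < s) :
    ∫ t in Ioi (0 : ℝ), ‖gaussConvPow n t * Real.exp (-(s * t))‖ ≤ s⁻¹ ^ (n + 1) := by
  rw [← integral_pow_div_factorial_mul_exp n hs]
  exact setIntegral_mono_on (integrableOn_gaussConvPow_mul_exp n hs).norm
    (integrableOn_pow_div_factorial_mul_exp n hs) measurableSet_Ioi fun t ht =>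
      norm_gaussConvPow_mul_exp_le n s (le_of_lt ht)

/-! ### The convolution exponential. -/

theorem hasSum_pow_succ_div_factorial (θ : ℝ) :
    HasSum (fun n : ℕ => θ ^ (n + 1) / (n + 1).factorial) (Real.exp θ - 1) := by
  have h : HasSum (fun n : ℕ => θ ^ n / n.factorial) (Real.exp θ) := by
    rw [Real.exp_eq_exp_ℝ]
    exact NormedSpace.expSeries_div_hasSum_exp θ
  simpa using (hasSum_nat_add_iff' 1).2 h

/-- The density of the measure `exp (θ • gaussKernel) - δ₀`, the exponential being taken in the
convolution algebra of the half-line. -/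
noncomputable def gaussConvExp (θ : ℝ) : ℝ → ℝ :=
  gaussConvSeries fun n => θ ^ (n + 1) / (n + 1).factorial

section Exp

variable {θ : ℝ}

theorem abs_pow_succ_div_factorial_le (hθ : 0 < θ) (n : ℕ) :
    |θ ^ (n + 1) / (n + 1).factorial| ≤ Real.exp θ := by
  rw [abs_of_pos (by positivity)]
  exact Real.pow_div_factorial_le_exp θ hθ.le _

theorem contDiff_gaussConvExp (hθ : 0 < θ) : ContDiff ℝ 1 (gaussConvExp θ) :=
  contDiff_gaussConvSeries (abs_pow_succ_div_factorial_le hθ)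

theorem hasSum_gaussConvExp (hθ : 0 < θ) (x : ℝ) :
    HasSum (fun n : ℕ => θ ^ (n + 1) / (n + 1).factorial * gaussConvPow n x) (gaussConvExp θ x) :=
  hasSum_gaussConvSeries (abs_pow_succ_div_factorial_le hθ) x

theorem exists_abs_gaussConvExp_le (hθ : 0 < θ) {ε : ℝ} (hε : 0 < ε) :
    ∃ C, 0 ≤ C ∧ ∀ x, 0 ≤ x → |gaussConvExp θ x| ≤ C * Real.exp (ε * x) := by
  -- Termwise, `x^n/n! ≤ ε^(-n) * exp(ε x)`, and the remaining coefficients `θ^(n+1) *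
  -- ε^(-n)/(n+1)!` sum to this constant.
  refine ⟨ε * (Real.exp (θ / ε) - 1), ?_, fun x hx => ?_⟩
  · have : 1 ≤ Real.exp (θ / ε) := Real.one_le_exp (by positivity)
    exact mul_nonneg hε.le (by linarith)
  · have hs := ((hasSum_pow_succ_div_factorial (θ / ε)).mul_left ε).mul_right (Real.exp (ε * x))
    refine (hasSum_gaussConvExp hθ x).norm_le_of_bounded hs fun n => ?_
    have h1 := abs_gaussConvPow_le n x
    rw [abs_of_nonneg hx] at h1
    have h2 := Real.pow_div_factorial_le_exp (ε * x) (by positivity) n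
    rw [norm_mul, Real.norm_of_nonneg (by positivity)]
    calc θ ^ (n + 1) / (n + 1).factorial * ‖gaussConvPow n x‖
        ≤ θ ^ (n + 1) / (n + 1).factorial * (x ^ n / n.factorial) := by gcongr; exact h1
      _ = ε * ((θ / ε) ^ (n + 1) / (n + 1).factorial) * ((ε * x) ^ n / n.factorial) := by
        rw [div_pow, mul_pow]
        field_simp
        ring
      _ ≤ _ := by gcongr

/-- Sum and integral may be exchanged because the L¹ norms of the terms are dominated by
`(θ/s)^(n+1)/(n+1)!`. -/
theorem laplace_gaussConvExp (hθ : 0 < θ) {s : ℝ} (hs : 0 < s) :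
    laplace (gaussConvExp θ) s = Real.exp (θ * laplace gaussKernel s) - 1 := by
  have hF := hasSum_integral_of_summable_integral_norm (μ := volume.restrict (Ioi (0 : ℝ)))
    (F := fun (n : ℕ) t => θ ^ (n + 1) / (n + 1).factorial *
      (gaussConvPow n t * Real.exp (-(s * t))))
    (fun n => (integrableOn_gaussConvPow_mul_exp n hs).const_mul _) ?_
  · have h1 : ∀ t, ∑' n : ℕ, θ ^ (n + 1) / (n + 1).factorial *
        (gaussConvPow n t * Real.exp (-(s * t))) = gaussConvExp θ t * Real.exp (-(s * t)) := by
      intro t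
      simp_rw [← mul_assoc]
      exact ((hasSum_gaussConvExp hθ t).mul_right _).tsum_eq
    simp_rw [h1, integral_const_mul] at hF
    refine hF.unique ?_
    convert! hasSum_pow_succ_div_factorial (θ * laplace gaussKernel s) using 2 with n
    rw [mul_pow, ← laplace_gaussConvPow n hs, laplace]
    ring
  · refine Summable.of_nonneg_of_le (fun n => integral_nonneg fun t => norm_nonneg _) (fun n => ?_)
      (hasSum_pow_succ_div_factorial (θ * s⁻¹)).summable
    simp_rw [norm_mul (_ / _), integral_const_mul]
    rw [Real.norm_of_nonneg (by positivity), mul_pow, mul_div_right_comm]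
    exact mul_le_mul_of_nonneg_left (integral_norm_gaussConvPow_mul_exp_le n hs) (by positivity)

theorem integrableOn_gaussConvExp_mul_exp (hθ : 0 < θ) {s : ℝ} (hs : 0 < s) :
    IntegrableOn (fun t => gaussConvExp θ t * Real.exp (-(s * t))) (Ioi 0) := by
  obtain ⟨C, -, hC⟩ := exists_abs_gaussConvExp_le hθ (half_pos hs)
  have := (contDiff_gaussConvExp hθ).continuous
  refine ((integrableOn_exp_neg_mul_Ioi (half_pos hs)).const_mul C).mono'
    (by fun_prop : Continuous _).aestronglyMeasurable
    (ae_restrict_of_forall_mem measurableSet_Ioi fun t ht => ?_)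
  rw [norm_mul, Real.norm_of_nonneg (Real.exp_pos _).le]
  refine (mul_le_mul_of_nonneg_right (hC t (le_of_lt ht)) (Real.exp_pos _).le).trans_eq ?_
  rw [mul_assoc, ← Real.exp_add]
  ring_nf

end Exp

/-! ### Integrals over `[0, 1]` against a merely integrable weight. -/

section WeightedIntegral

variable {w : ℝ → ℝ}

theorem continuous_integral_mul_of_continuous (hw : IntervalIntegrable w volume 0 1)
    {F : ℝ → ℝ → ℝ} (hF : Continuous F.uncurry) :
    Continuous fun x => ∫ u in (0 : ℝ)..1, w u * F x u := by
  rw [continuous_iff_continuousAt]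
  intro x
  obtain ⟨C, hC⟩ := ((isCompact_closedBall x 1).prod
    (isCompact_uIcc (a := (0 : ℝ)) (b := 1))).exists_bound_of_continuousOn hF.continuousOn
  have hm : AEStronglyMeasurable w (volume.restrict (uIoc 0 1)) :=
    (intervalIntegrable_iff.1 hw).aestronglyMeasurable
  refine intervalIntegral.continuousAt_of_dominated_interval (bound := fun u => ‖w u‖ * C)
    (Eventually.of_forall fun y =>
      hm.mul (hF.uncurry_left y).aestronglyMeasurable) ?_ (hw.norm.mul_const C)
    (ae_of_all _ fun u _ => ((hF.uncurry_right u).const_mul (w u)).continuousAt)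
  filter_upwards [Metric.closedBall_mem_nhds x one_pos] with y hy
  refine ae_of_all _ fun u hu => ?_
  rw [norm_mul]
  exact mul_le_mul_of_nonneg_left (hC (y, u) ⟨hy, uIoc_subset_uIcc hu⟩) (norm_nonneg _)

/-- The weight, possibly singular, does not depend on `x`, so differentiation under the integral
falls on `h` alone. -/
theorem contDiff_integral_mul_comp_scaled (hw : IntervalIntegrable w volume 0 1)
    {h : ℝ → ℝ} (hh : ContDiff ℝ 1 h) :
    ContDiff ℝ 1 fun x => ∫ u in (0 : ℝ)..1, w u * h (x * (1 - u)) := by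
  have hh' : Continuous (deriv h) := hh.continuous_deriv le_rfl
  have hhc : Continuous h := hh.continuous
  have hm : AEStronglyMeasurable w (volume.restrict (uIoc 0 1)) :=
    (intervalIntegrable_iff.1 hw).aestronglyMeasurable
  have hd : ∀ x, HasDerivAt (fun x => ∫ u in (0 : ℝ)..1, w u * h (x * (1 - u)))
      (∫ u in (0 : ℝ)..1, w u * (deriv h (x * (1 - u)) * (1 - u))) x := by
    intro x
    obtain ⟨C, hC⟩ := ((isCompact_closedBall x 1).prod
      (isCompact_uIcc (a := (0 : ℝ)) (b := 1))).exists_bound_of_continuousOn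
      (f := fun p : ℝ × ℝ => deriv h (p.1 * (1 - p.2)) * (1 - p.2)) (by fun_prop)
    refine (intervalIntegral.hasDerivAt_integral_of_dominated_loc_of_deriv_le
      (F := fun x u => w u * h (x * (1 - u)))
      (F' := fun x u => w u * (deriv h (x * (1 - u)) * (1 - u)))
      (bound := fun u => ‖w u‖ * C) (Metric.closedBall_mem_nhds x one_pos)
      (Eventually.of_forall fun y =>
        hm.mul (by fun_prop : Continuous fun u => h (y * (1 - u))).aestronglyMeasurable)
      (hw.mul_continuousOn (by fun_prop))
      (hm.mul (by fun_prop : Continuous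
        fun u => deriv h (x * (1 - u)) * (1 - u)).aestronglyMeasurable)
      (ae_of_all _ fun u hu y hy => ?_) (hw.norm.mul_const C)
      (ae_of_all _ fun u _ y _ => ?_)).2
    · rw [norm_mul]
      exact mul_le_mul_of_nonneg_left (hC (y, u) ⟨hy, uIoc_subset_uIcc hu⟩) (norm_nonneg _)
    · have h1 := (hh.differentiable one_ne_zero (y * (1 - u))).hasDerivAt
      exact (h1.comp y ((hasDerivAt_id y).mul_const (1 - u))).const_mul (w u) |>.congr_deriv
        (by simp)
  rw [contDiff_one_iff_deriv]
  refine ⟨fun x => (hd x).differentiableAt, ?_⟩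
  rw [funext fun x => (hd x).deriv]
  exact continuous_integral_mul_of_continuous hw
    (F := fun x u => deriv h (x * (1 - u)) * (1 - u)) (by fun_prop)

end WeightedIntegral

/-! ### The density: regularity and asymptotics. -/

section Profile

variable {θ : ℝ}

/-- The function `∫₀¹ u ^ (θ - 1) * gaussConvExp θ (x * (1 - u)) du`. -/
noncomputable def betaAverage (θ x : ℝ) : ℝ :=
  ∫ u in (0 : ℝ)..1, u ^ (θ - 1) * gaussConvExp θ (x * (1 - u))

theorem intervalIntegrable_rpow_sub_one (hθ : 0 < θ) (a b : ℝ) :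
    IntervalIntegrable (fun u : ℝ => u ^ (θ - 1)) volume a b :=
  intervalIntegral.intervalIntegrable_rpow' (by linarith)

theorem contDiff_betaAverage (hθ : 0 < θ) : ContDiff ℝ 1 (betaAverage θ) :=
  contDiff_integral_mul_comp_scaled (intervalIntegrable_rpow_sub_one hθ 0 1)
    (contDiff_gaussConvExp hθ)

theorem exists_abs_betaAverage_le (hθ : 0 < θ) {ε : ℝ} (hε : 0 < ε) :
    ∃ C, 0 ≤ C ∧ ∀ x, 0 ≤ x → |betaAverage θ x| ≤ C * Real.exp (ε * x) := by
  obtain ⟨C, hC0, hC⟩ := exists_abs_gaussConvExp_le hθ hε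
  -- `θ⁻¹` is the integral of `u^(θ-1)` over `[0, 1]`.
  refine ⟨θ⁻¹ * C, by positivity, fun x hx => ?_⟩
  have h1 : ∫ u in (0 : ℝ)..1, u ^ (θ - 1) * (C * Real.exp (ε * x)) =
      θ⁻¹ * C * Real.exp (ε * x) := by
    rw [intervalIntegral.integral_mul_const, integral_rpow (Or.inl (by linarith))]
    simp [Real.zero_rpow hθ.ne', mul_assoc]
  rw [← h1, ← Real.norm_eq_abs, betaAverage]
  refine intervalIntegral.norm_integral_le_of_norm_le zero_le_one (ae_of_all _ fun u hu => ?_)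
    ((intervalIntegrable_rpow_sub_one hθ 0 1).mul_const _)
  have hu0 : 0 ≤ u := hu.1.le
  have hu1 : 0 ≤ 1 - u := by linarith [hu.2]
  rw [norm_mul, Real.norm_of_nonneg (by positivity : 0 ≤ u ^ (θ - 1))]
  refine mul_le_mul_of_nonneg_left ((hC _ (by positivity)).trans ?_) (by positivity)
  refine mul_le_mul_of_nonneg_left (Real.exp_le_exp.2 ?_) hC0
  exact mul_le_mul_of_nonneg_left (mul_le_of_le_one_right hx (by linarith)) hε.le

/-- The smooth factor of the density. -/
noncomputable def densityProfile (θ x : ℝ) : ℝ :=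
  Real.exp (-(1 / 2 * x)) * (1 + x * betaAverage θ x)

theorem contDiff_densityProfile (hθ : 0 < θ) : ContDiff ℝ 1 (densityProfile θ) := by
  have := contDiff_betaAverage hθ
  unfold densityProfile
  fun_prop

/-- The function on the line with one-sided Fourier transform
`exp (-θ * digamma (1 / 2 - I * z))`. -/
noncomputable def digammaDensity (θ x : ℝ) : ℝ :=
  if 0 < x then (Real.Gamma θ)⁻¹ * x ^ (θ - 1) * densityProfile θ x else 0

theorem digammaDensity_of_pos {x : ℝ} (hx : 0 < x) :
    digammaDensity θ x = (Real.Gamma θ)⁻¹ * x ^ (θ - 1) * densityProfile θ x := if_pos hx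

theorem digammaDensity_of_nonpos {x : ℝ} (hx : x ≤ 0) : digammaDensity θ x = 0 :=
  if_neg hx.not_gt

theorem contDiffOn_digammaDensity (hθ : 0 < θ) : ContDiffOn ℝ 1 (digammaDensity θ) (Ioi 0) := by
  have h : ContDiffOn ℝ 1 (fun x => (Real.Gamma θ)⁻¹ * x ^ (θ - 1) * densityProfile θ x)
      (Ioi 0) := fun x hx =>
    ((contDiffAt_const.mul (Real.contDiffAt_rpow_const_of_ne (ne_of_gt hx))).mul
      (contDiff_densityProfile hθ).contDiffAt).contDiffWithinAt
  exact h.congr fun x hx => digammaDensity_of_pos hx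

theorem continuousOn_digammaDensity (hθ : 0 < θ) : ContinuousOn (digammaDensity θ) {0}ᶜ := by
  intro x hx
  refine ContinuousAt.continuousWithinAt ?_
  rcases lt_or_gt_of_ne (show x ≠ 0 from hx) with h | h
  · refine (continuousAt_const (y := (0 : ℝ))).congr ?_
    filter_upwards [eventually_lt_nhds h] with y hy using (digammaDensity_of_nonpos hy.le).symm
  · exact (contDiffOn_digammaDensity hθ).continuousOn.continuousAt (Ioi_mem_nhds h)

theorem continuous_digammaDensity (hθ : 1 < θ) : Continuous (digammaDensity θ) := by
  have hp := (contDiff_densityProfile (zero_lt_one.trans hθ)).continuous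
  -- For `θ > 1` the power of `max x 0` is continuous and vanishes for `x ≤ 0`, so one formula
  -- covers both branches.
  have h1 : Continuous fun x : ℝ =>
      (Real.Gamma θ)⁻¹ * (max x 0) ^ (θ - 1) * densityProfile θ x :=
    (continuous_const.mul ((Real.continuous_rpow_const (by linarith)).comp
      (continuous_id.max continuous_const))).mul hp
  refine h1.congr fun x => ?_
  rcases le_or_gt x 0 with hx | hx
  · rw [max_eq_right hx, Real.zero_rpow (by linarith), digammaDensity_of_nonpos hx]
    ring
  · rw [max_eq_left hx.le, digammaDensity_of_pos hx]

/-- The profile is differentiable at 0 with value 1 there, so it differs from 1 by `O(x)`. -/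
theorem digammaDensity_sub_isBigO (hθ : 0 < θ) :
    (fun x : ℝ => digammaDensity θ x - (Real.Gamma θ)⁻¹ * x ^ (θ - 1)) =O[𝓝[>] 0]
      (fun x : ℝ => x ^ θ) := by
  have h0 : densityProfile θ 0 = 1 := by simp [densityProfile]
  have h1 : (fun x => densityProfile θ x - 1) =O[𝓝[>] 0] (fun x : ℝ => x) := by
    have := ((contDiff_densityProfile hθ).differentiable one_ne_zero 0).isBigO_sub
    simp only [h0, sub_zero] at this
    exact this.mono nhdsWithin_le_nhds
  have h2 := ((isBigO_refl (fun x : ℝ => x ^ (θ - 1)) (𝓝[>] 0)).mul h1).const_mul_left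
    (Real.Gamma θ)⁻¹
  refine h2.congr' ?_ ?_
  · filter_upwards [self_mem_nhdsWithin] with x hx
    rw [digammaDensity_of_pos hx]
    ring
  · filter_upwards [self_mem_nhdsWithin] with x hx
    rw [Real.rpow_sub_one (ne_of_gt hx), div_mul_cancel₀ _ (ne_of_gt hx)]

theorem digammaDensity_isBigO_exp (hθ : 0 < θ) {κ : ℝ} (hκ : κ < 1 / 2) :
    digammaDensity θ =O[atTop] (fun x : ℝ => Real.exp (-κ * x)) := by
  -- The gap `1/2 - κ` is spent in two halves: one `exp(ε x)` bounds `betaAverage`, the other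
  -- absorbs `x^θ`.
  set ε := (1 / 2 - κ) / 2 with hε
  have hε0 : 0 < ε := by rw [hε]; linarith
  obtain ⟨C, hC0, hC⟩ := exists_abs_betaAverage_le hθ hε0
  have h1 : (fun x => 1 + x * betaAverage θ x) =O[atTop] fun x => x * Real.exp (ε * x) := by
    refine IsBigO.of_bound (1 + C) ?_
    filter_upwards [eventually_ge_atTop 1] with x hx
    have hx0 : 0 ≤ x := by linarith
    have he : 1 ≤ Real.exp (ε * x) := Real.one_le_exp (by positivity)
    have h2 := mul_le_mul_of_nonneg_left (hC x hx0) hx0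
    have h3 : 1 ≤ x * Real.exp (ε * x) := by nlinarith
    rw [Real.norm_eq_abs, Real.norm_of_nonneg (by positivity)]
    refine (abs_add_le _ _).trans ?_
    rw [abs_one, abs_mul, abs_of_nonneg hx0]
    linarith
  have h2 : (fun x : ℝ => x ^ (θ - 1) * x) =O[atTop] fun x => Real.exp (ε * x) := by
    refine ((isLittleO_rpow_exp_pos_mul_atTop θ hε0).isBigO).congr' ?_ EventuallyEq.rfl
    filter_upwards [eventually_gt_atTop 0] with x hx
    rw [Real.rpow_sub_one hx.ne', div_mul_cancel₀ _ hx.ne']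
  have h3 := (((isBigO_refl (fun x : ℝ => x ^ (θ - 1) * Real.exp (-(1 / 2 * x))) atTop).mul
    h1).const_mul_left (Real.Gamma θ)⁻¹)
  have h4 := h2.mul (isBigO_refl (fun x : ℝ => Real.exp (-(1 / 2 * x)) * Real.exp (ε * x)) atTop)
  refine (h3.congr' ?_ EventuallyEq.rfl).trans (h4.congr (fun x => by ring) fun x => ?_)
  · filter_upwards [eventually_gt_atTop 0] with x hx
    rw [digammaDensity_of_pos hx, densityProfile]
    ring
  · rw [← Real.exp_add, ← Real.exp_add, hε]
    ring_nf

end Profile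

/-! ### The Laplace transform of the density at real points. -/

section Laplace

variable {θ : ℝ}

/-- Undoing the scaling `t = x u` recovers the convolution, the form suited to the Laplace
transform. -/
theorem digammaDensity_mul_exp_half {x : ℝ} (hx : 0 < x) :
    digammaDensity θ x * Real.exp (1 / 2 * x) = (Real.Gamma θ)⁻¹ *
      (x ^ (θ - 1) + ∫ t in (0 : ℝ)..x, t ^ (θ - 1) * gaussConvExp θ (x - t)) := by
  have h1 := intervalIntegral.smul_integral_comp_mul_left (a := 0) (b := 1)
    (fun t => t ^ (θ - 1) * gaussConvExp θ (x - t)) x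
  have h2 : ∫ u in (0 : ℝ)..1, (x * u) ^ (θ - 1) * gaussConvExp θ (x - x * u) =
      x ^ (θ - 1) * betaAverage θ x := by
    rw [betaAverage, ← intervalIntegral.integral_const_mul]
    refine intervalIntegral.integral_congr fun u hu => ?_
    rw [uIcc_of_le zero_le_one] at hu
    simp only [Real.mul_rpow hx.le hu.1, mul_sub, mul_one, mul_assoc]
  rw [mul_zero, mul_one, h2, smul_eq_mul] at h1
  have h3 : Real.exp (-(1 / 2 * x)) * Real.exp (1 / 2 * x) = 1 := by
    rw [← Real.exp_add, neg_add_cancel, Real.exp_zero]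
  rw [← h1, digammaDensity_of_pos hx, densityProfile]
  linear_combination (Real.Gamma θ)⁻¹ * x ^ (θ - 1) * (1 + x * betaAverage θ x) * h3

theorem integrableOn_digammaDensity_mul_exp (hθ : 0 < θ) {s : ℝ} (hs : 0 < s) :
    IntegrableOn (fun x => digammaDensity θ x * Real.exp (1 / 2 * x) * Real.exp (-(s * x)))
      (Ioi 0) := by
  have h1 := integrableOn_rpow_mul_exp_neg_mul_Ioi hθ hs
  have h2 := integrableOn_integral_mul_comp_sub_mul_exp h1 (integrableOn_gaussConvExp_mul_exp hθ hs)
  refine IntegrableOn.congr_fun ((h1.add h2).const_mul (Real.Gamma θ)⁻¹) (fun x hx => ?_)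
    measurableSet_Ioi
  simp only [digammaDensity_mul_exp_half (mem_Ioi.1 hx), Pi.add_apply]
  ring

theorem laplace_digammaDensity (hθ : 0 < θ) {s : ℝ} (hs : 0 < s) :
    laplace (fun x => digammaDensity θ x * Real.exp (1 / 2 * x)) s =
      Real.exp (-θ * realDigamma s) := by
  have h1 := integrableOn_rpow_mul_exp_neg_mul_Ioi hθ hs
  have h2 := integrableOn_integral_mul_comp_sub_mul_exp h1 (integrableOn_gaussConvExp_mul_exp hθ hs)
  have h3 := laplace_integral_mul_comp_sub h1 (integrableOn_gaussConvExp_mul_exp hθ hs)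
  have h4 : laplace (fun x => x ^ (θ - 1)) s = (1 / s) ^ θ * Real.Gamma θ :=
    Real.integral_rpow_mul_exp_neg_mul_Ioi hθ hs
  have h5 : laplace (fun x => digammaDensity θ x * Real.exp (1 / 2 * x)) s =
      (Real.Gamma θ)⁻¹ * (laplace (fun x => x ^ (θ - 1)) s +
        laplace (fun x => ∫ t in (0 : ℝ)..x, t ^ (θ - 1) * gaussConvExp θ (x - t)) s) := by
    simp only [laplace]
    rw [← integral_add h1 h2, ← integral_const_mul]
    refine setIntegral_congr_fun measurableSet_Ioi fun x hx => ?_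
    simp only [digammaDensity_mul_exp_half (mem_Ioi.1 hx)]
    ring
  have hΓ := (Real.Gamma_pos_of_pos hθ).ne'
  rw [h5, h3, laplace_gaussConvExp hθ hs, h4, realDigamma_eq_log_sub_laplace hs,
    show -θ * (Real.log s - laplace gaussKernel s) =
      Real.log s * -θ + θ * laplace gaussKernel s by ring, Real.exp_add,
    ← Real.rpow_def_of_pos hs, one_div, Real.inv_rpow hs.le, Real.rpow_neg hs.le]
  field_simp
  ring

end Laplace

/-! ### Analytic continuation to the half-plane `Re s > 0`. -/

theorem aestronglyMeasurable_mul_cexp {f : ℝ → ℝ}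
    (hf : IntegrableOn (fun t => f t * Real.exp (-(1 * t))) (Ioi 0)) {g : ℝ → ℂ}
    (hg : Continuous g) :
    AEStronglyMeasurable (fun t => (f t : ℂ) * g t) (volume.restrict (Ioi 0)) := by
  have h1 : AEStronglyMeasurable (fun t => ((f t * Real.exp (-(1 * t)) : ℝ) : ℂ))
      (volume.restrict (Ioi 0)) := hf.ofReal.aestronglyMeasurable
  have h2 : Continuous fun t : ℝ => Complex.exp (t : ℂ) * g t := by fun_prop
  refine (h1.mul h2.aestronglyMeasurable).congr (ae_of_all _ fun t => ?_)
  have : Complex.exp (-(1 * t)) * Complex.exp t = 1 := by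
    rw [← Complex.exp_add]; simp
  simp only [Pi.mul_apply]
  push_cast
  linear_combination (f t : ℂ) * g t * this

theorem integrableOn_mul_cexp {f : ℝ → ℝ}
    (hf : ∀ s : ℝ, 0 < s → IntegrableOn (fun t => f t * Real.exp (-(s * t))) (Ioi 0))
    {s : ℂ} (hs : 0 < s.re) :
    IntegrableOn (fun t : ℝ => (f t : ℂ) * Complex.exp (-(s * t))) (Ioi 0) := by
  refine (hf s.re hs).norm.mono' (aestronglyMeasurable_mul_cexp (hf 1 one_pos) (by fun_prop))
    (ae_of_all _ fun t => ?_)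
  rw [norm_mul, norm_mul, Complex.norm_exp, Complex.norm_real,
    Real.norm_of_nonneg (Real.exp_pos _).le]
  simp

/-- The Laplace transform is holomorphic on the half-plane of absolute convergence. -/
theorem differentiableOn_integral_mul_cexp {f : ℝ → ℝ}
    (hf : ∀ s : ℝ, 0 < s → IntegrableOn (fun t => f t * Real.exp (-(s * t))) (Ioi 0)) :
    DifferentiableOn ℂ (fun s : ℂ => ∫ t in Ioi (0 : ℝ), (f t : ℂ) * Complex.exp (-(s * t)))
      {s | 0 < s.re} := by
  intro z hz
  rw [mem_ofPred] at hz
  -- On `Re s > δ` half of the decay `exp(-δ t)` absorbs the factor `t` produced by differentiation;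
  -- the other half gives an integrable bound.
  set δ := z.re / 2 with hδ
  have hδ0 : 0 < δ := by positivity
  have hnhds : {s : ℂ | δ < s.re} ∈ 𝓝 z :=
    (isOpen_lt continuous_const Complex.continuous_re).mem_nhds
      (show δ < z.re by rw [hδ]; linarith)
  refine (hasDerivAt_integral_of_dominated_loc_of_deriv_le
    (F := fun (s : ℂ) (t : ℝ) => (f t : ℂ) * Complex.exp (-(s * t)))
    (F' := fun (s : ℂ) (t : ℝ) => (f t : ℂ) * (Complex.exp (-(s * t)) * -t))
    (bound := fun t => ‖f t * Real.exp (-(δ / 2 * t))‖ * (2 / δ)) hnhds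
    (Eventually.of_forall fun s => aestronglyMeasurable_mul_cexp (hf 1 one_pos) (by fun_prop))
    (integrableOn_mul_cexp hf hz) (aestronglyMeasurable_mul_cexp (hf 1 one_pos) (by fun_prop))
    (ae_restrict_of_forall_mem measurableSet_Ioi fun t ht s hs => ?_)
    ((hf (δ / 2) (by positivity)).norm.mul_const _)
    (ae_of_all _ fun t s _ => ?_)).2.differentiableAt.differentiableWithinAt
  · have ht0 : 0 < t := ht
    have h1 : t ≤ Real.exp (δ / 2 * t) * (2 / δ) := by
      have := Real.add_one_le_exp (δ / 2 * t)
      calc t = δ / 2 * t * (2 / δ) := by field_simp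
        _ ≤ _ := by gcongr; linarith
    have h2 : Real.exp (-(s.re * t)) ≤ Real.exp (-(δ * t)) := by
      have hs' : δ < s.re := hs
      gcongr
    rw [norm_mul, norm_mul, norm_mul, Complex.norm_exp, Complex.norm_real, norm_neg,
      Complex.norm_real, Real.norm_of_nonneg ht0.le, Real.norm_of_nonneg (Real.exp_pos _).le,
      mul_assoc]
    refine mul_le_mul_of_nonneg_left ?_ (norm_nonneg _)
    have h3 : (-(s * (t : ℂ))).re = -(s.re * t) := by simp
    rw [h3]
    calc Real.exp (-(s.re * t)) * t
        ≤ Real.exp (-(δ * t)) * (Real.exp (δ / 2 * t) * (2 / δ)) := by gcongr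
      _ = Real.exp (-(δ / 2 * t)) * (2 / δ) := by
        rw [← mul_assoc, ← Real.exp_add]
        ring_nf
  · have h1 : HasDerivAt (fun s : ℂ => -(s * (t : ℂ))) (-(t : ℂ)) s :=
      (hasDerivAt_mul_const (t : ℂ)).fun_neg
    exact h1.cexp.const_mul _

theorem differentiableOn_digamma : DifferentiableOn ℂ Complex.digamma {s | 0 < s.re} := by
  have hopen : IsOpen {s : ℂ | 0 < s.re} := isOpen_lt continuous_const Complex.continuous_re
  have h1 : DifferentiableOn ℂ Complex.Gamma {s | 0 < s.re} := fun s hs =>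
    (Complex.differentiableAt_Gamma s fun m h => by
      have hs' : 0 < s.re := hs
      rw [h] at hs'
      simp only [Complex.neg_re, Complex.natCast_re] at hs'
      linarith [(m.cast_nonneg : (0 : ℝ) ≤ m)]).differentiableWithinAt
  exact (h1.deriv hopen).div h1 fun s hs => Complex.Gamma_ne_zero_of_re_pos hs

theorem exp_neg_mul_digamma_eq_integral {θ : ℝ} (hθ : 0 < θ) {s : ℂ} (hs : 0 < s.re) :
    Complex.exp (-(θ : ℂ) * Complex.digamma s) = ∫ t in Ioi (0 : ℝ),
      ((digammaDensity θ t * Real.exp (1 / 2 * t) : ℝ) : ℂ) * Complex.exp (-(s * t)) := by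
  have hopen : IsOpen {s : ℂ | 0 < s.re} := isOpen_lt continuous_const Complex.continuous_re
  have h1 : DifferentiableOn ℂ (fun s => Complex.exp (-(θ : ℂ) * Complex.digamma s))
      {s | 0 < s.re} := (differentiableOn_digamma.const_mul _).cexp
  have h2 := differentiableOn_integral_mul_cexp fun s hs =>
    integrableOn_digammaDensity_mul_exp hθ (s := s) hs
  refine (h1.analyticOnNhd hopen).eqOn_of_preconnected_of_frequently_eq (h2.analyticOnNhd hopen)
    (convex_halfSpace_re_gt 0).isPreconnected (z₀ := 1) (by simp) ?_ hs
  -- Real points near 1 accumulate at 1, which is enough for the identity theorem.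
  have hreal : ∀ᶠ r : ℝ in 𝓝[≠] 1, Complex.exp (-(θ : ℂ) * Complex.digamma r) =
      ∫ t in Ioi (0 : ℝ),
        ((digammaDensity θ t * Real.exp (1 / 2 * t) : ℝ) : ℂ) * Complex.exp (-(r * t)) := by
    filter_upwards [eventually_nhdsWithin_of_eventually_nhds (eventually_gt_nhds one_pos)]
      with r hr
    rw [digamma_ofReal hr]
    have h3 := laplace_digammaDensity hθ hr
    rw [laplace] at h3
    have h4 := congrArg (fun r : ℝ => (r : ℂ)) h3
    simp only [← integral_complex_ofReal] at h4
    push_cast at h4 ⊢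
    exact h4.symm
  have htend : Tendsto (fun r : ℝ => (r : ℂ)) (𝓝[≠] 1) (𝓝[≠] 1) := by
    refine tendsto_nhdsWithin_of_tendsto_nhds_of_eventually_within _ ?_ ?_
    · exact (Complex.continuous_ofReal.tendsto' 1 1 Complex.ofReal_one).mono_left
        nhdsWithin_le_nhds
    · filter_upwards [self_mem_nhdsWithin] with r hr
      simpa using hr
  exact htend.frequently hreal.frequently

theorem proposition2 (θ : ℝ) (hθ : 0 < θ) :
    ∃ Ψ : ℝ → ℝ,
      -- continuity; at `x = 0` only when `θ > 1`, since `Ψ` jumps or blows up there if `θ ≤ 1`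
      ContinuousOn Ψ {0}ᶜ ∧
      (1 < θ → Continuous Ψ) ∧
      ContDiffOn ℝ 1 Ψ (Ioi 0) ∧
      -- the one-sided Fourier integral formula, with an absolutely convergent integral
      (∀ z : ℂ, -(1 / 2 : ℝ) < z.im →
        IntegrableOn (fun x : ℝ => (Ψ x : ℂ) * Complex.exp (Complex.I * z * (x : ℂ)))
          (Ioi 0) volume ∧
        Complex.exp (-(θ : ℂ) * Complex.digamma (1 / 2 - Complex.I * z)) =
          ∫ x in Ioi (0 : ℝ), (Ψ x : ℂ) * Complex.exp (Complex.I * z * (x : ℂ))) ∧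
      (∀ x : ℝ, x < 0 → Ψ x = 0) ∧
      (fun x : ℝ => Ψ x - (Real.Gamma θ)⁻¹ * x ^ (θ - 1)) =O[𝓝[>] 0] (fun x : ℝ => x ^ θ) ∧
      (∀ κ : ℝ, κ < 1 / 2 → Ψ =O[atTop] (fun x : ℝ => Real.exp (-κ * x))) := by
  refine ⟨digammaDensity θ, continuousOn_digammaDensity hθ, continuous_digammaDensity,
    contDiffOn_digammaDensity hθ, fun z hz => ?_, fun x hx => digammaDensity_of_nonpos hx.le,
    digammaDensity_sub_isBigO hθ, fun κ hκ => digammaDensity_isBigO_exp hθ hκ⟩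
  have hs : 0 < (1 / 2 - Complex.I * z).re := by
    simp
    linarith
  have key : (fun x : ℝ => ((digammaDensity θ x * Real.exp (1 / 2 * x) : ℝ) : ℂ) *
      Complex.exp (-((1 / 2 - Complex.I * z) * x))) =
      fun x : ℝ => (digammaDensity θ x : ℂ) * Complex.exp (Complex.I * z * (x : ℂ)) := by
    ext x
    push_cast
    rw [mul_assoc, ← Complex.exp_add]
    ring_nf
  have h1 := integrableOn_mul_cexp
    (fun s hs => integrableOn_digammaDensity_mul_exp hθ (s := s) hs) hs
  have h2 := exp_neg_mul_digamma_eq_integral hθ hs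
  rw [key] at h1 h2
  exact ⟨h1, h2⟩
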